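/- Let $n\ge 2$, let $X_1,\dots,X_n$ be real Hilbert spaces with dual spaces $X_i'$, let $\mathbf X=X_1\times\cdots\times X_n$ with the product norm, and let $\langle\cdot,\cdot\rangle$ denote the duality product. Let $A_i:X_i\to X_i'$ ($i=1,\dots,n$) and $B_i:X_i\to X_{i+1}'$ ($i=1,\dots,n-1$) be bounded linear operators, where the $A_i$ satisfy $\langle A_iy,x\rangle=\langle A_ix,y\rangle$ and $\langle A_ix,x\rangle\ge 0$ for all $x,y\in X_i$. Let $B_i':X_{i+1}\to X_i'$ be given by $\langle B_i'y,x\rangle=\langle B_ix,y\rangle$. Put $S_1=A_1$ and $S_{i+1}=A_{i+1}+B_iS_i^{-1}B_i'$ for $i=1,\dots,n-1$, and assume that these operators are well-defined and positive definite: for each $i$ there is $\sigma_i>0$ with $\langle S_ix,x\rangle\ge\sigma_i\|x\|_{X_i}^2$ for all $x\in X_i$. Define $$\mathcal A=\begin{pmatrix}A_1&B_1'&&\\B_1&-A_2&\ddots&\\&\ddots&\ddots&B_{n-1}'\\&&B_{n-1}&(-1)^{n-1}A_n\end{pmatrix}:\mathbf X\to\mathbf X',\qquad \mathcal S=\operatorname{diag}(S_1,\dots,S_n):\mathbf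 X\to\mathbf X',\qquad \mathcal M=\mathcal S^{-1}\mathcal A:\mathbf X\to\mathbf X .$$ Equip $\mathbf X$ with the norm $\|\mathbf x\|_{\mathcal S}=\langle\mathcal S\mathbf x,\mathbf x\rangle^{1/2}$ and $\mathbf X'$ with the corresponding dual norm, and let $\kappa(T)=\|T\|\,\|T^{-1}\|$ with the operator norms that belong to these norms. Then $\mathcal A:\mathbf X\to\mathbf X'$ and $\mathcal M:\mathbf X\to\mathbf X$ are isomorphisms. With $C_i=S_{i+1}^{-1}B_i$ and $C_i^*=S_i^{-1}B_i'$, which are adjoint to each other with respect to the inner products $\langle S_i\,\cdot,\cdot\rangle$ on $X_i$ and $\langle S_{i+1}\,\cdot,\cdot\rangle$ on $X_{i+1}$, the operator $\mathcal M$ has the block form $$\mathcal M=\begin{pmatrix}I&C_1^*&&\\C_1&-(I-C_1C_1^*)&\ddots&\\&\ddots&\ddots&C_{n-1}^*\\&&C_{n-1}&(-1)^{n-1}(I-C_{n-1}C_{n-1}^*)\end{pmatrix}.$$ Moreover, $$\kappa(\mathcal A)=\kappa(\mathcal M)\le\frac{\cos\left(\frac{\pi}{2n+1}\right)}{\sin\left(\frac{\pi}{2(2n+1)}\right)}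 .$$ For $n=2$ this gives $\kappa(\mathcal M)\le\frac{3+\sqrt5}{2}$. -/

import Mathlib

open scoped ENNReal

namespace MultipleSaddle

noncomputable section

/-! ### Norms of operators with respect to prescribed norms -/

section Norms

/-- The operator norm of `T : E → F` when `E` carries the norm `p` and `F` carries the norm `q`:
the smallest `c` with `q (T x) ≤ c * p x` for all `x`. It is `∞` if `T` is unbounded. -/
def opNormWrt {E F : Type*} (p : E → ℝ≥0∞) (q : F → ℝ≥0∞) (T : E → F) : ℝ≥0∞ :=
  sInf {c : ℝ≥0∞ | ∀ x, q (T x) ≤ c * p x}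

variable {E F : Type*} [NormedAddCommGroup E] [NormedSpace ℝ E]
  [NormedAddCommGroup F] [NormedSpace ℝ F]

/-- The norm `‖x‖_T = ⟨T x, x⟩ ^ (1/2)` induced by a positive definite `T : E → E'`. -/
def energyNorm (T : E →L[ℝ] StrongDual ℝ E) (x : E) : ℝ≥0∞ :=
  ENNReal.ofReal (Real.sqrt (T x x))

/-- The norm on the dual space `E'` that is dual to the norm `‖·‖_T` on `E`. -/
def dualEnergyNorm (T : E →L[ℝ] StrongDual ℝ E) (f : StrongDual ℝ E) : ℝ≥0∞ :=
  opNormWrt (energyNorm T) (fun t : ℝ => ‖t‖ₑ) f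

/-- The condition number `‖T‖ ‖T⁻¹‖` of an invertible bounded linear operator `T : E → F`,
where `E` carries the norm `p` and `F` carries the norm `q`. -/
def condNumber (p : E → ℝ≥0∞) (q : F → ℝ≥0∞) (T : E →L[ℝ] F) : ℝ≥0∞ :=
  opNormWrt p q T * opNormWrt q p T.inverse

end Norms

/-! ### Block operators

The spaces are `X 0, …, X m`, so the number of blocks is `n = m + 1`. The duality product `⟨f, x⟩`
is `f x`, and the Banach space adjoint `B' : Y → X'` of `B : X → Y'` is `B.flip`,
as `⟨B' y, x⟩ = ⟨B x, y⟩`. -/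

section Blocks

variable {m : ℕ} {X : Fin (m + 1) → Type*} [∀ i, NormedAddCommGroup (X i)]
  [∀ i, InnerProductSpace ℝ (X i)]

/-- The operator from `X₀ × ⋯ × Xₘ` (with the Hilbert space product norm) to its dual whose only
nonzero block is `K`, in row `j` and column `i`. -/
def dualBlock (i j : Fin (m + 1)) (K : X i →L[ℝ] StrongDual ℝ (X j)) :
    PiLp 2 X →L[ℝ] StrongDual ℝ (PiLp 2 X) :=
  K.bilinearComp (PiLp.proj 2 X i) (PiLp.proj 2 X j)

/-- The operator from `X₀ × ⋯ × Xₘ` to itself whose only nonzero block is `K`,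
in row `j` and column `i`. -/
def block (i j : Fin (m + 1)) (K : X i →L[ℝ] X j) : PiLp 2 X →L[ℝ] PiLp 2 X :=
  ((PiLp.continuousLinearEquiv 2 ℝ X).symm : (∀ k, X k) →L[ℝ] PiLp 2 X) ∘L
    ContinuousLinearMap.single ℝ X j ∘L K ∘L PiLp.proj 2 X i

variable (A : ∀ i : Fin (m + 1), X i →L[ℝ] StrongDual ℝ (X i))
  (B : ∀ i : Fin m, X i.castSucc →L[ℝ] StrongDual ℝ (X i.succ))

/-- The block tridiagonal operator `𝒜` with diagonal `A₀, -A₁, A₂, …, (-1)ᵐ Aₘ`, with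
`B₀, …, Bₘ₋₁` below the diagonal and their adjoints above it. -/
def saddleOp : PiLp 2 X →L[ℝ] StrongDual ℝ (PiLp 2 X) :=
  (∑ i : Fin (m + 1), dualBlock i i ((-1 : ℝ) ^ (i : ℕ) • A i)) +
    ∑ i : Fin m,
      (dualBlock i.castSucc i.succ (B i) + dualBlock i.succ i.castSucc (B i).flip)

/-- The Schur complements: `S₀ = A₀` and `Sᵢ₊₁ = Aᵢ₊₁ + Bᵢ Sᵢ⁻¹ Bᵢ'`. -/
def schur (i : Fin (m + 1)) : X i →L[ℝ] StrongDual ℝ (X i) :=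
  Fin.induction (motive := fun i => X i →L[ℝ] StrongDual ℝ (X i)) (A 0)
    (fun i S => A i.succ + B i ∘L S.inverse ∘L (B i).flip) i

/-- The block diagonal Schur complement preconditioner `𝒮 = diag (S₀, …, Sₘ)`. -/
def schurPrec : PiLp 2 X →L[ℝ] StrongDual ℝ (PiLp 2 X) :=
  ∑ i : Fin (m + 1), dualBlock i i (schur A B i)

/-- The preconditioned operator `ℳ = 𝒮⁻¹ 𝒜`. -/
def precOp : PiLp 2 X →L[ℝ] PiLp 2 X :=
  (schurPrec A B).inverse ∘L saddleOp A B

/-- `Cᵢ = Sᵢ₊₁⁻¹ Bᵢ`. -/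
def couplingOp (i : Fin m) : X i.castSucc →L[ℝ] X i.succ :=
  (schur A B i.succ).inverse ∘L B i

/-- `Cᵢ* = Sᵢ⁻¹ Bᵢ'`. -/
def couplingAdj (i : Fin m) : X i.succ →L[ℝ] X i.castSucc :=
  (schur A B i.castSucc).inverse ∘L (B i).flip

/-- The block tridiagonal operator on `X₀ × ⋯ × Xₘ` with diagonal
`I, -(I - C₀ C₀*), …, (-1)ᵐ (I - Cₘ₋₁ Cₘ₋₁*)`, with the `Cᵢ` below the diagonal and the
`Cᵢ*` above it. -/
def precBlockOp : PiLp 2 X →L[ℝ] PiLp 2 X :=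
  block 0 0 (ContinuousLinearMap.id ℝ (X 0)) +
    ∑ i : Fin m,
      (block i.succ i.succ ((-1 : ℝ) ^ ((i : ℕ) + 1) •
          (ContinuousLinearMap.id ℝ (X i.succ) - couplingOp A B i ∘L couplingAdj A B i)) +
        block i.castSucc i.succ (couplingOp A B i) +
        block i.succ i.castSucc (couplingAdj A B i))

end Blocks

end

end MultipleSaddle

namespace MultipleSaddle

/-! ### Positive definite forms and operator norms -/

section Forms

variable {E : Type*} [NormedAddCommGroup E]

section Normed

variable [NormedSpace ℝ E]

/-! `ℳ` is self-adjoint for the inner product of `𝒮`, so the norms of `ℳ` and `ℳ⁻¹` are controlled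
by their quadratic forms. With `ψ = π / (2(2n+1))` the bounds are `‖ℳ‖ ≤ 2 cos 2ψ` and `‖ℳ⁻¹‖ ≤ 1 /
(2 sin ψ)`, and their product is the claim.

For `ℳ`, `abs_saddleOp_apply_self_le` estimates each coupling by Young's inequality with a weight
`tᵢ`. For `ℳ⁻¹`, factor `ℳ = L U` into block bidiagonal operators with diagonal blocks `±I`. With `g
= U x`, the form `⟨𝒜 x, x⟩` becomes the alternating sum of the energies of the `gᵢ`, while `ℳ x = L
g`; `mul_alternating_sum_le` compares the two by completing squares with weights `rᵢ`. Both sums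
telescope exactly when the weights satisfy scalar three-term recursions, solved by quotients of
trigonometric functions; `ψ` is such that the weights keep the required bounds up to the last block.
-/

/-- A symmetric form whose quadratic form is dominated by that of `c • P` satisfies a
Cauchy-Schwarz inequality with respect to `P`. -/
theorem sq_apply_le_of_abs_apply_self_le (a P : E →L[ℝ] StrongDual ℝ E) (c : ℝ)
    (ha : ∀ x y, a x y = a y x) (h : ∀ x, |a x x| ≤ c * P x x) (x y : E) :
    a x y ^ 2 ≤ c ^ 2 * P x x * P y y := by
  -- Polarization: the hypothesis at `x + t • y` and at `x - t • y` is combined so that the cross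
  -- terms of `P` cancel.
  have key : ∀ t : ℝ, 0 ≤ (c * P y y) * (t * t) + (-2 * a x y) * t + c * P x x := by
    intro t
    have h1 := (abs_le.1 (h (x + t • y))).2
    have h2 := (abs_le.1 (h (x - t • y))).1
    simp only [map_add, map_sub, map_smul, add_apply,
      sub_apply, smul_apply, smul_eq_mul] at h1 h2
    rw [ha y x] at h1 h2
    nlinarith
  have := discrim_le_zero key
  rw [discrim] at this
  nlinarith

/-- For a self-adjoint operator the numerical radius bounds the norm: apply the Cauchy-Schwarz
inequality above to `x` and `T x`, then cancel one factor `P (T x) (T x)`. -/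
theorem opNormWrt_energyNorm_le (P : E →L[ℝ] StrongDual ℝ E) (hP : ∀ x, 0 ≤ P x x)
    (T : E →L[ℝ] E) {c : ℝ} (hc : 0 ≤ c) (hT : ∀ x y, P (T x) y = P (T y) x)
    (h : ∀ x, |P (T x) x| ≤ c * P x x) :
    opNormWrt (energyNorm P) (energyNorm P) T ≤ ENNReal.ofReal c := by
  refine sInf_le fun x => ?_
  have h1 := sq_apply_le_of_abs_apply_self_le (P ∘L T) P c hT h x (T x)
  simp only [ContinuousLinearMap.comp_apply] at h1
  have h2 : P (T x) (T x) ≤ c ^ 2 * P x x := by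
    rcases (hP (T x)).eq_or_lt with h0 | h0
    · rw [← h0]; exact mul_nonneg (sq_nonneg c) (hP x)
    · rw [sq] at h1
      exact le_of_mul_le_mul_right h1 h0
  rw [energyNorm, energyNorm, ← ENNReal.ofReal_mul hc]
  refine ENNReal.ofReal_le_ofReal ?_
  calc √(P (T x) (T x)) ≤ √(c ^ 2 * P x x) := Real.sqrt_le_sqrt h2
    _ = c * √(P x x) := by rw [Real.sqrt_mul (sq_nonneg c), Real.sqrt_sq hc]

/-- Riesz isometry: Cauchy-Schwarz gives one inequality, testing the functional with `y` itself the
other. -/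
theorem dualEnergyNorm_apply (P : E →L[ℝ] StrongDual ℝ E) (hP : ∀ x, 0 ≤ P x x)
    (hs : ∀ x y, P x y = P y x) (y : E) :
    dualEnergyNorm P (P y) = energyNorm P y := by
  refine le_antisymm (sInf_le fun x => ?_) (le_sInf fun c hc => ?_)
  · have h1 := sq_apply_le_of_abs_apply_self_le P P 1 hs
      (fun x => by rw [one_mul, abs_of_nonneg (hP x)]) y x
    change ‖P y x‖ₑ ≤ _
    rw [energyNorm, energyNorm, ← ENNReal.ofReal_mul (Real.sqrt_nonneg _),
      ← ofReal_norm, Real.norm_eq_abs, ← Real.sqrt_mul (hP y)]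
    refine ENNReal.ofReal_le_ofReal (Real.le_sqrt_of_sq_le ?_)
    rw [sq_abs]; linarith
  · have h1 : ‖P y y‖ₑ ≤ c * energyNorm P y := hc y
    rcases (hP y).eq_or_lt with h0 | h0
    · simp [energyNorm, ← h0]
    · have h2 : ‖P y y‖ₑ = energyNorm P y * energyNorm P y := by
        rw [energyNorm, ← ENNReal.ofReal_mul (Real.sqrt_nonneg _), Real.mul_self_sqrt (hP y),
          ← ofReal_norm, Real.norm_eq_abs, abs_of_nonneg (hP y)]
      have h3 : energyNorm P y ≠ 0 := by simp [energyNorm, h0]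
      rw [h2] at h1
      exact (ENNReal.mul_le_mul_iff_left h3 ENNReal.ofReal_ne_top).1 h1

/-- Preconditioning with an isometry `P : E → E'` does not change the condition number. -/
theorem condNumber_dualEnergyNorm_eq (P : E →L[ℝ] StrongDual ℝ E) (hP : ∀ x, 0 ≤ P x x)
    (hs : ∀ x y, P x y = P y x) (hi : P.IsInvertible) (T : E →L[ℝ] StrongDual ℝ E)
    (hT : T.IsInvertible) :
    condNumber (energyNorm P) (dualEnergyNorm P) T =
      condNumber (energyNorm P) (energyNorm P) (P.inverse ∘L T) := by
  obtain ⟨e, rfl⟩ := hi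
  obtain ⟨f, rfl⟩ := hT
  have h1 : opNormWrt (energyNorm (e : E →L[ℝ] StrongDual ℝ E)) (dualEnergyNorm e)
        (f : E →L[ℝ] StrongDual ℝ E) =
      opNormWrt (energyNorm (e : E →L[ℝ] StrongDual ℝ E)) (energyNorm e)
        ((e : E →L[ℝ] StrongDual ℝ E).inverse ∘L (f : E →L[ℝ] StrongDual ℝ E)) := by
    unfold opNormWrt
    congr 1
    ext c
    refine forall_congr' fun x => ?_
    have := dualEnergyNorm_apply (e : E →L[ℝ] StrongDual ℝ E) hP hs (e.symm (f x))
    simp only [ContinuousLinearEquiv.coe_coe, ContinuousLinearEquiv.apply_symm_apply] at this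
    simp [this]
  have h2 : opNormWrt (dualEnergyNorm e) (energyNorm (e : E →L[ℝ] StrongDual ℝ E))
        (f : E →L[ℝ] StrongDual ℝ E).inverse =
      opNormWrt (energyNorm (e : E →L[ℝ] StrongDual ℝ E)) (energyNorm e)
        ((e : E →L[ℝ] StrongDual ℝ E).inverse ∘L (f : E →L[ℝ] StrongDual ℝ E)).inverse := by
    have h3 : ((e : E →L[ℝ] StrongDual ℝ E).inverse ∘L (f : E →L[ℝ] StrongDual ℝ E)).inverse =
        ((e.trans f.symm : E ≃L[ℝ] E) : E →L[ℝ] E) := by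
      rw [ContinuousLinearMap.inverse_equiv]
      exact ContinuousLinearMap.inverse_equiv (f.trans e.symm)
    unfold opNormWrt
    congr 1
    ext c
    rw [h3, ContinuousLinearMap.inverse_equiv]
    simp only [Set.mem_ofPred_eq]
    -- Every functional is some `e x`, so the dual norm turns into the energy norm of `x`.
    refine e.surjective.forall.trans (forall_congr' fun x => ?_)
    have := dualEnergyNorm_apply (e : E →L[ℝ] StrongDual ℝ E) hP hs x
    simp only [ContinuousLinearEquiv.coe_coe] at this
    simp [this]
  rw [condNumber, condNumber, h1, h2]

end Normed

theorem isInvertible_of_bijective {F : Type*} [NormedSpace ℝ E] [CompleteSpace E]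
    [NormedAddCommGroup F] [NormedSpace ℝ F] [CompleteSpace F] (T : E →L[ℝ] F)
    (hT : Function.Bijective T) : T.IsInvertible :=
  ⟨ContinuousLinearEquiv.ofBijective T (LinearMap.ker_eq_bot.2 hT.1)
    (LinearMap.range_eq_top.2 hT.2), ContinuousLinearEquiv.coe_ofBijective T _ _⟩

/-- Lax-Milgram: a coercive operator `E → E'` is invertible. -/
theorem isInvertible_of_coercive [InnerProductSpace ℝ E] [CompleteSpace E]
    (P : E →L[ℝ] StrongDual ℝ E) (h : ∃ σ : ℝ, 0 < σ ∧ ∀ x, σ * ‖x‖ ^ 2 ≤ P x x) :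
    P.IsInvertible := by
  have hc : IsCoercive P := by
    obtain ⟨σ, hσ, h⟩ := h
    exact ⟨σ, hσ, fun x => by simpa [sq, mul_assoc] using h x⟩
  refine ⟨hc.continuousLinearEquivOfBilin.trans
    (InnerProductSpace.toDual ℝ E).toContinuousLinearEquiv, ?_⟩
  ext x y
  simp

end Forms

/-! ### Trigonometric recursions -/

section Trig

open Real

/-- Pivots of the tridiagonal matrix `2 cos 2ψ - M`, where `M` has ones next to the diagonal and
diagonal `1, 0, …, 0`. -/
theorem exists_pivots (m : ℕ) {ψ : ℝ} (hψ : (2 * m + 3) * ψ = π / 2) :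
    ∃ t : ℕ → ℝ, t 0 = 2 * cos (2 * ψ) - 1 ∧
      (∀ k < m, 0 < t k ∧ t k ≤ 1 ∧ t (k + 1) = 2 * cos (2 * ψ) - (t k)⁻¹) ∧ 0 ≤ t m := by
  have hψ0 : 0 < ψ := by
    have := pi_pos
    by_contra! h
    nlinarith [mul_nonneg (by positivity : (0 : ℝ) ≤ 2 * m + 3) (neg_nonneg.2 h)]
  have hpos : ∀ k : ℕ, k ≤ m → 0 < cos ((2 * k + 1) * ψ) := by
    intro k hk
    have hk' : (k : ℝ) ≤ m := by exact_mod_cast hk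
    refine cos_pos_of_mem_Ioo ⟨?_, ?_⟩
    · have : 0 < (2 * k + 1) * ψ := by positivity
      linarith [pi_pos]
    · rw [← hψ]; exact mul_lt_mul_of_pos_right (by linarith) hψ0
  -- Stated for real `k` so that `k = -1` also yields the initial value.
  have hrec : ∀ k : ℝ, cos ((2 * (k + 1) + 3) * ψ) + cos ((2 * k + 1) * ψ) =
      2 * cos (2 * ψ) * cos ((2 * k + 3) * ψ) := by
    intro k
    rw [show (2 * (k + 1) + 3) * ψ = (2 * k + 3) * ψ + 2 * ψ by ring,
      show (2 * k + 1) * ψ = (2 * k + 3) * ψ - 2 * ψ by ring, cos_add, cos_sub]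
    ring
  -- Consecutive quotients of the solution `cos ((2k+1)ψ)` of the linear recursion; the numerator at
  -- `k = m` is `cos (π / 2) = 0`.
  refine ⟨fun k => cos ((2 * k + 3) * ψ) / cos ((2 * k + 1) * ψ), ?_, fun k hk => ?_, ?_⟩
  · have h := hpos 0 (Nat.zero_le _)
    have h' := hrec (-1)
    simp only [Nat.cast_zero, mul_zero, zero_add, one_mul] at h ⊢
    rw [div_eq_iff h.ne']
    norm_num at h'
    linarith
  · have h0 := hpos k hk.le
    have h1 := hpos (k + 1) hk
    push_cast at h1 ⊢
    rw [show 2 * ((k : ℝ) + 1) + 1 = 2 * k + 3 by ring] at h1 ⊢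
    refine ⟨div_pos h1 h0, (div_le_one h0).2 ?_, ?_⟩
    · have hk' : (k : ℝ) + 1 ≤ m := by exact_mod_cast hk
      refine cos_le_cos_of_nonneg_of_le_pi (by positivity) ?_
        (mul_le_mul_of_nonneg_right (by linarith) hψ0.le)
      have : (2 * k + 3) * ψ ≤ (2 * m + 3) * ψ :=
        mul_le_mul_of_nonneg_right (by linarith) hψ0.le
      linarith [pi_pos]
    · rw [inv_div, eq_sub_iff_add_eq, ← add_div, div_eq_iff h1.ne']
      exact hrec k
  · simp only
    rw [hψ, cos_pi_div_two, zero_div]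

/-- Pivots of the form `∑ (gᵢ₊₁ - gᵢ)² - 2 σ sin ψ ∑ (-1)ⁱ gᵢ²`, up to a shift by one. -/
theorem exists_alternating_pivots (m : ℕ) {ψ : ℝ} (hψ : (2 * m + 3) * ψ = π / 2) (σ : ℝ)
    (hσ : σ ^ 2 = 1) :
    ∃ r : ℕ → ℝ, r 0 = 2 - σ * (2 * sin ψ) ∧
      (∀ k, k < m → r (k + 1) = 2 - σ * (-1) ^ (k + 1) * (2 * sin ψ) - (r k)⁻¹) ∧
      ∀ k, k ≤ m → 1 ≤ r k := by
  have hψ0 : 0 < ψ := by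
    have := pi_pos
    by_contra! h
    nlinarith [mul_nonneg (by positivity : (0 : ℝ) ≤ 2 * m + 3) (neg_nonneg.2 h)]
  have hψ1 : ψ < π / 2 := by
    rw [← hψ]
    nlinarith [mul_nonneg (Nat.cast_nonneg m : (0 : ℝ) ≤ m) hψ0.le]
  have hs : 0 < sin ψ := sin_pos_of_pos_of_lt_pi hψ0 (by linarith)
  have hc : 0 < cos ψ := cos_pos_of_mem_Ioo ⟨by linarith, hψ1⟩
  have hs1 : sin ψ < 1 := by nlinarith [sin_sq_add_cos_sq ψ]
  have hpos : ∀ k : ℕ, k ≤ m + 1 → 0 < sin ((k + 1) * ψ) := by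
    intro k hk
    have hk' : (k : ℝ) ≤ m + 1 := by exact_mod_cast hk
    refine sin_pos_of_pos_of_lt_pi (by positivity) ?_
    have : (k + 1) * ψ ≤ (2 * m + 3) * ψ :=
      mul_le_mul_of_nonneg_right (by linarith [(Nat.cast_nonneg m : (0 : ℝ) ≤ m)]) hψ0.le
    linarith [pi_pos]
  have hη : ∀ k : ℕ, (σ * (-1) ^ k) ^ 2 = 1 := by
    intro k
    rw [mul_pow, hσ, ← pow_mul, mul_comm k 2, pow_mul]; simp
  have hηs : ∀ k : ℕ, 1 - sin ψ ≤ 1 - σ * (-1) ^ k * sin ψ := by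
    intro k
    have := (abs_le_of_sq_le_sq' (a := σ * (-1) ^ k) (b := 1) (by rw [hη k]; norm_num) zero_le_one).2
    nlinarith
  -- The first factor becomes its inverse when `k` increases by one, since `(1 - sin ψ)(1 + sin ψ) =
  -- cos² ψ`. This absorbs the alternating sign and leaves the recursion of `sin ((k+1)ψ)`.
  refine ⟨fun k => (1 - σ * (-1) ^ k * sin ψ) / cos ψ * (sin ((k + 2) * ψ) / sin ((k + 1) * ψ)),
    ?_, fun k hk => ?_, fun k hk => ?_⟩
  · simp only [Nat.cast_zero, zero_add, one_mul, pow_zero, mul_one, sin_two_mul]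
    field_simp
  · have h0 := hpos k (by omega)
    have h1 := hpos (k + 1) (by omega)
    have h2 := hη k
    have h3 : 0 < 1 - σ * (-1) ^ k * sin ψ := by linarith [hηs k]
    push_cast at h1 ⊢
    rw [show (k : ℝ) + 1 + 1 = k + 2 by ring] at h1 ⊢
    have h4 : sin ((k + 1 + 2) * ψ) + sin ((k + 1) * ψ) = 2 * cos ψ * sin ((k + 2) * ψ) := by
      rw [show (k + 1 + 2 : ℝ) * ψ = (k + 2) * ψ + ψ by ring,
        show (k + 1 : ℝ) * ψ = (k + 2) * ψ - ψ by ring, sin_add, sin_sub]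
      ring
    have h5 : ((1 - σ * (-1) ^ k * sin ψ) / cos ψ)⁻¹ =
        (1 - σ * (-1) ^ (k + 1) * sin ψ) / cos ψ := by
      rw [inv_div, div_eq_div_iff h3.ne' hc.ne', pow_succ]
      linear_combination (sin ψ) ^ 2 * h2 + sin_sq_add_cos_sq ψ
    rw [mul_inv, h5, inv_div, eq_sub_iff_add_eq, ← mul_add, ← add_div, h4]
    field_simp
  · have h0 := hpos k (by omega)
    have h1 := hpos (k + 1) (by omega)
    push_cast at h1
    rw [show (k : ℝ) + 1 + 1 = k + 2 by ring] at h1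
    have hk' : (k : ℝ) ≤ m := by exact_mod_cast hk
    simp only
    rw [div_mul_div_comm, one_le_div (mul_pos hc h0)]
    -- The bound `1 ≤ r k` reduces to this in the worst sign case; it amounts to `(2k+3)ψ ≤ π / 2`,
    -- which is where `k ≤ m` enters.
    have h2 : sin ((k + 2) * ψ) ≤ cos ((k + 1) * ψ) := by
      rw [← sin_pi_div_two_sub]
      have h3 : (k + 2) * ψ ≤ π / 2 - (k + 1) * ψ := by
        rw [← hψ]; nlinarith
      refine sin_le_sin_of_le_of_le_pi_div_two ?_ ?_ h3
      · have : 0 < (k + 2) * ψ := by positivity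
        linarith
      · have : 0 < (k + 1) * ψ := by positivity
        linarith
    have h3 : sin ((k + 2) * ψ) = sin ((k + 1) * ψ) * cos ψ + cos ((k + 1) * ψ) * sin ψ := by
      rw [← sin_add]; ring_nf
    have h4 := mul_le_mul_of_nonneg_right (hηs k) h1.le
    nlinarith [mul_le_mul_of_nonneg_left h2 hs.le]

theorem cos_pi_div_five_div_sin_pi_div_ten : cos (π / 5) / sin (π / 10) = (3 + √5) / 2 := by
  have h5 : √5 ^ 2 = 5 := Real.sq_sqrt (by norm_num)
  have h5' : 1 < √5 := by
    rw [Real.lt_sqrt] <;> norm_num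
  have h1 : sin (π / 10) ^ 2 = ((√5 - 1) / 4) ^ 2 := by
    have h := cos_two_mul (π / 10)
    rw [show 2 * (π / 10) = π / 5 by ring, cos_pi_div_five, cos_sq'] at h
    nlinarith
  have h2 : 0 ≤ sin (π / 10) := sin_nonneg_of_nonneg_of_le_pi (by positivity) (by linarith [pi_pos])
  rw [(sq_eq_sq₀ h2 (by linarith)).1 h1, cos_pi_div_five]
  rw [div_eq_iff (by linarith)]
  nlinarith

end Trig

/-! ### Schur complements -/

section Blocks

variable {m : ℕ} {X : Fin (m + 1) → Type*} [∀ i, NormedAddCommGroup (X i)]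
  [∀ i, InnerProductSpace ℝ (X i)]

variable (A : ∀ i : Fin (m + 1), X i →L[ℝ] StrongDual ℝ (X i))
  (B : ∀ i : Fin m, X i.castSucc →L[ℝ] StrongDual ℝ (X i.succ))

theorem schur_zero : schur A B 0 = A 0 := rfl

theorem schur_succ (i : Fin m) : schur A B i.succ =
    A i.succ + B i ∘L (schur A B i.castSucc).inverse ∘L (B i).flip := rfl

theorem dualBlock_apply (i j : Fin (m + 1)) (K : X i →L[ℝ] StrongDual ℝ (X j))
    (x y : PiLp 2 X) : dualBlock i j K x y = K (x i) (y j) := rfl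

theorem schurPrec_apply (x y : PiLp 2 X) :
    schurPrec A B x y = ∑ i, schur A B i (x i) (y i) := by
  simp [schurPrec, dualBlock_apply]

theorem saddleOp_apply (x y : PiLp 2 X) :
    saddleOp A B x y = ∑ i : Fin (m + 1), (-1 : ℝ) ^ (i : ℕ) * A i (x i) (y i) +
      ∑ i : Fin m, (B i (x i.castSucc) (y i.succ) + B i (y i.castSucc) (x i.succ)) := by
  simp [saddleOp, dualBlock_apply]

theorem schurPrec_block (i j : Fin (m + 1)) (K : X i →L[ℝ] X j) (x y : PiLp 2 X) :
    schurPrec A B (block i j K x) y = schur A B j (K (x i)) (y j) := by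
  rw [schurPrec_apply, Finset.sum_eq_single j]
  · simp [block]
  · intro k _ hk
    simp [block, Pi.single_eq_of_ne hk]
  · simp

variable {A B}

theorem schur_couplingOp (hi : ∀ i, (schur A B i).IsInvertible) (i : Fin m) (x : X i.castSucc) :
    schur A B i.succ (couplingOp A B i x) = B i x :=
  (hi i.succ).self_apply_inverse _

theorem schur_couplingAdj (hi : ∀ i, (schur A B i).IsInvertible) (i : Fin m) (y : X i.succ) :
    schur A B i.castSucc (couplingAdj A B i y) = (B i).flip y :=
  (hi i.castSucc).self_apply_inverse _

/-- Induction: the added term pairs `Cᵢ* x` with `Cᵢ* y` in the previous Schur complement, which is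
already symmetric. -/
theorem schur_symm (hA_symm : ∀ i (x y : X i), A i y x = A i x y)
    (hi : ∀ i, (schur A B i).IsInvertible) (i : Fin (m + 1)) :
    ∀ x y : X i, schur A B i x y = schur A B i y x := by
  induction i using Fin.induction with
  | zero => exact fun x y => hA_symm 0 y x
  | succ i ih =>
    intro x y
    have h := ih (couplingAdj A B i y) (couplingAdj A B i x)
    rw [schur_couplingAdj hi, schur_couplingAdj hi] at h
    have h2 := hA_symm i.succ y x
    rw [schur_succ]
    simp only [add_apply, ContinuousLinearMap.comp_apply]
    rw [h2]
    exact congrArg _ h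

/-- `Cᵢ` and `Cᵢ*` are adjoint to each other. -/
theorem schur_couplingAdj_apply (hi : ∀ i, (schur A B i).IsInvertible)
    (i : Fin m) (x : X i.castSucc) (y : X i.succ) :
    schur A B i.castSucc (couplingAdj A B i y) x = schur A B i.succ (couplingOp A B i x) y := by
  rw [schur_couplingAdj hi, schur_couplingOp hi, ContinuousLinearMap.flip_apply]

theorem schur_succ_apply (hi : ∀ i, (schur A B i).IsInvertible) (i : Fin m) (x y : X i.succ) :
    schur A B i.succ x y =
      A i.succ x y + schur A B i.succ (couplingOp A B i (couplingAdj A B i x)) y := by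
  rw [schur_couplingOp hi]
  rfl

/-- Energy balance: the correction term of the Schur complement is the energy of `Cᵢ* x`. With `A ≥
0` it makes `Cᵢ*` a contraction. -/
theorem schur_couplingAdj_self_eq (hi : ∀ i, (schur A B i).IsInvertible)
    (i : Fin m) (x : X i.succ) :
    A i.succ x x = schur A B i.succ x x -
      schur A B i.castSucc (couplingAdj A B i x) (couplingAdj A B i x) := by
  rw [schur_succ_apply hi, schur_couplingAdj_apply hi]
  ring

theorem schur_couplingAdj_self_le (hi : ∀ i, (schur A B i).IsInvertible)
    (hA_nonneg : ∀ i (x : X i), 0 ≤ A i x x) (i : Fin m) (x : X i.succ) :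
    schur A B i.castSucc (couplingAdj A B i x) (couplingAdj A B i x) ≤ schur A B i.succ x x := by
  have := hA_nonneg i.succ x
  rw [schur_couplingAdj_self_eq hi] at this
  linarith

/-- The adjoint of a contraction is a contraction: expand the nonnegative energy of `x - Cᵢ* Cᵢ x`
and bound that of `Cᵢ* Cᵢ x` by that of `Cᵢ x`. -/
theorem schur_couplingOp_self_le (hi : ∀ i, (schur A B i).IsInvertible)
    (hA_symm : ∀ i (x y : X i), A i y x = A i x y)
    (hA_nonneg : ∀ i (x : X i), 0 ≤ A i x x)
    (hS : ∀ i (x : X i), 0 ≤ schur A B i x x) (i : Fin m) (x : X i.castSucc) :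
    schur A B i.succ (couplingOp A B i x) (couplingOp A B i x) ≤ schur A B i.castSucc x x := by
  have h1 := schur_couplingAdj_self_le hi hA_nonneg i (couplingOp A B i x)
  have h2 := hS i.castSucc (x - couplingAdj A B i (couplingOp A B i x))
  simp only [map_sub, sub_apply] at h2
  rw [schur_symm hA_symm hi _ x (couplingAdj A B i _),
    schur_couplingAdj_apply hi i x] at h2
  linarith

/-! ### Block bidiagonal factorization. -/

variable (A B)

/-- The upper bidiagonal operator with diagonal `(-1)ⁱ` and `Cᵢ*` above it. -/
noncomputable def upper (x : ∀ i, X i) : ∀ i, X i :=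
  Fin.lastCases ((-1 : ℝ) ^ m • x (Fin.last m))
    fun i => (-1 : ℝ) ^ (i : ℕ) • x i.castSucc + couplingAdj A B i (x i.succ)

/-- The lower bidiagonal operator with diagonal `I` and `(-1)ⁱ Cᵢ` below it. -/
noncomputable def lower (g : ∀ i, X i) : ∀ i, X i :=
  Fin.cases (g 0) fun i => g i.succ + (-1 : ℝ) ^ (i : ℕ) • couplingOp A B i (g i.castSucc)

theorem upper_last (x : ∀ i, X i) :
    upper A B x (Fin.last m) = (-1 : ℝ) ^ m • x (Fin.last m) := by
  simp [upper]

theorem upper_castSucc (x : ∀ i, X i) (i : Fin m) : upper A B x i.castSucc =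
    (-1 : ℝ) ^ (i : ℕ) • x i.castSucc + couplingAdj A B i (x i.succ) := by
  simp [upper]

theorem lower_zero (g : ∀ i, X i) : lower A B g 0 = g 0 := rfl

theorem lower_succ (g : ∀ i, X i) (i : Fin m) : lower A B g i.succ =
    g i.succ + (-1 : ℝ) ^ (i : ℕ) • couplingOp A B i (g i.castSucc) := rfl

theorem neg_one_pow_smul_neg_one_pow_smul {V : Type*} [AddCommGroup V] [Module ℝ V] (k : ℕ)
    (v : V) : (-1 : ℝ) ^ k • (-1 : ℝ) ^ k • v = v := by
  rw [smul_smul, ← mul_pow]; simp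

/-- Back substitution from the last block; the diagonal `±I` is invertible whatever the couplings
are. -/
theorem upper_bijective : Function.Bijective (upper A B) := by
  refine ⟨fun x y h => ?_, fun g => ?_⟩
  · ext i
    induction i using Fin.reverseInduction with
    | last =>
      have := congrArg ((-1 : ℝ) ^ m • ·) (congrFun h (Fin.last m))
      simpa only [upper_last, neg_one_pow_smul_neg_one_pow_smul] using this
    | cast i ih =>
      have := congrFun h i.castSucc
      rw [upper_castSucc, upper_castSucc, ih, add_left_inj] at this
      have := congrArg ((-1 : ℝ) ^ (i : ℕ) • ·) this
      simpa only [neg_one_pow_smul_neg_one_pow_smul] using this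
  · refine ⟨fun i => Fin.reverseInduction (motive := X) ((-1 : ℝ) ^ m • g (Fin.last m))
      (fun i y => (-1 : ℝ) ^ (i : ℕ) • (g i.castSucc - couplingAdj A B i y)) i, ?_⟩
    ext i
    induction i using Fin.lastCases with
    | last =>
      rw [upper_last, Fin.reverseInduction_last, neg_one_pow_smul_neg_one_pow_smul]
    | cast i =>
      rw [upper_castSucc, Fin.reverseInduction_castSucc, neg_one_pow_smul_neg_one_pow_smul,
        sub_add_cancel]

theorem lower_bijective : Function.Bijective (lower A B) := by
  refine ⟨fun x y h => ?_, fun g => ?_⟩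
  · ext i
    induction i using Fin.induction with
    | zero => exact congrFun h 0
    | succ i ih =>
      have := congrFun h i.succ
      rwa [lower_succ, lower_succ, ih, add_left_inj] at this
  · refine ⟨fun i => Fin.induction (motive := X) (g 0)
      (fun i y => g i.succ - (-1 : ℝ) ^ (i : ℕ) • couplingOp A B i y) i, ?_⟩
    ext i
    induction i using Fin.cases with
    | zero => rfl
    | succ i =>
      rw [lower_succ, Fin.induction_succ, sub_add_cancel]

variable {A B}

/-- The block factorization of `𝒜`, tested with `y`. -/
theorem saddleOp_apply_eq_sum (hi : ∀ i, (schur A B i).IsInvertible) (x y : PiLp 2 X) :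
    saddleOp A B x y = ∑ i, schur A B i (lower A B (upper A B x.ofLp) i) (y i) := by
  set g := upper A B x.ofLp with hg
  have h1 : ∑ i, schur A B i (lower A B g i) (y i) = ∑ i, schur A B i (g i) (y i) +
      ∑ i : Fin m, (-1 : ℝ) ^ (i : ℕ) *
        schur A B i.succ (couplingOp A B i (g i.castSucc)) (y i.succ) := by
    rw [Fin.sum_univ_succ, Fin.sum_univ_succ (fun i => schur A B i (g i) (y i)), add_assoc,
      ← Finset.sum_add_distrib]
    simp [lower_zero, lower_succ]
  have h2 : ∑ i, schur A B i (g i) (y i) =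
      ∑ i : Fin (m + 1), (-1 : ℝ) ^ (i : ℕ) * schur A B i (x i) (y i) +
      ∑ i : Fin m, schur A B i.castSucc (couplingAdj A B i (x i.succ)) (y i.castSucc) := by
    rw [Fin.sum_univ_castSucc, Fin.sum_univ_castSucc
      (fun i : Fin (m + 1) => (-1 : ℝ) ^ (i : ℕ) * schur A B i (x i) (y i)), add_right_comm,
      ← Finset.sum_add_distrib]
    simp [hg, upper_last, upper_castSucc]
  rw [h1, h2, saddleOp_apply, Fin.sum_univ_succ, Fin.sum_univ_succ, schur_zero, add_assoc,
    add_assoc, add_assoc, ← Finset.sum_add_distrib, ← Finset.sum_add_distrib,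
    ← Finset.sum_add_distrib]
  refine congrArg _ (Finset.sum_congr rfl fun i _ => ?_)
  rw [schur_succ_apply hi i (x i.succ), schur_couplingAdj hi, hg, upper_castSucc, map_add, map_smul,
    map_add, map_smul, schur_couplingOp hi i (x i.castSucc), ContinuousLinearMap.flip_apply]
  simp only [add_apply, smul_apply, smul_eq_mul, Fin.val_succ]
  have h3 : (-1 : ℝ) ^ (i : ℕ) * (-1) ^ (i : ℕ) = 1 := by rw [← mul_pow]; simp
  rw [pow_succ]
  linear_combination (-(B i) (x i.castSucc) (y i.succ)) * h3

theorem saddleOp_eq (hi : ∀ i, (schur A B i).IsInvertible) (x : PiLp 2 X) :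
    saddleOp A B x = schurPrec A B (WithLp.toLp 2 (lower A B (upper A B x.ofLp))) := by
  ext y
  rw [saddleOp_apply_eq_sum hi, schurPrec_apply]

theorem schurPrec_precBlockOp (hi : ∀ i, (schur A B i).IsInvertible) (x : PiLp 2 X) :
    schurPrec A B (precBlockOp A B x) = saddleOp A B x := by
  ext y
  rw [precBlockOp, saddleOp_apply]
  simp only [add_apply, sum_apply, map_add, map_sum, schurPrec_block]
  rw [Fin.sum_univ_succ, add_assoc, ← Finset.sum_add_distrib]
  simp only [ContinuousLinearMap.id_apply, schur_zero, Fin.val_zero, pow_zero, one_mul, smul_apply,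
    sub_apply, ContinuousLinearMap.comp_apply, map_smul, map_sub, smul_eq_mul,
    schur_couplingOp hi _ (x _), schur_couplingAdj hi, ContinuousLinearMap.flip_apply]
  refine congrArg _ (Finset.sum_congr rfl fun i _ => ?_)
  rw [schur_succ_apply hi i (x i.succ), Fin.val_succ]
  ring

theorem schurPrec_symm (hi : ∀ i, (schur A B i).IsInvertible)
    (hA_symm : ∀ i (x y : X i), A i y x = A i x y) (x y : PiLp 2 X) :
    schurPrec A B x y = schurPrec A B y x := by
  rw [schurPrec_apply, schurPrec_apply]
  exact Finset.sum_congr rfl fun i _ => schur_symm hA_symm hi i _ _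

theorem schurPrec_coercive
    (hS : ∀ i, ∃ σ : ℝ, 0 < σ ∧ ∀ x : X i, σ * ‖x‖ ^ 2 ≤ schur A B i x x) :
    ∃ σ : ℝ, 0 < σ ∧ ∀ x, σ * ‖x‖ ^ 2 ≤ schurPrec A B x x := by
  choose σ hσ h using hS
  obtain ⟨i, hi⟩ := Finite.exists_min σ
  refine ⟨σ i, hσ i, fun x => ?_⟩
  rw [schurPrec_apply, PiLp.norm_sq_eq_of_L2, Finset.mul_sum]
  exact Finset.sum_le_sum fun j _ =>
    (mul_le_mul_of_nonneg_right (hi j) (sq_nonneg _)).trans (h j (x j))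

theorem saddleOp_symm (hA_symm : ∀ i (x y : X i), A i y x = A i x y) (x y : PiLp 2 X) :
    saddleOp A B x y = saddleOp A B y x := by
  rw [saddleOp_apply, saddleOp_apply]
  congr 1
  · exact Finset.sum_congr rfl fun i _ => by rw [hA_symm]
  · exact Finset.sum_congr rfl fun i _ => add_comm _ _

/-- `𝒜 = 𝒮 L U` is a composition of bijections, and the open mapping theorem makes the inverse
bounded. -/
theorem saddleOp_isInvertible [∀ i, CompleteSpace (X i)]
    (hS : ∀ i, ∃ σ : ℝ, 0 < σ ∧ ∀ x : X i, σ * ‖x‖ ^ 2 ≤ schur A B i x x) :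
    (saddleOp A B).IsInvertible := by
  have hi : ∀ i, (schur A B i).IsInvertible := fun i => isInvertible_of_coercive _ (hS i)
  have hP : (schurPrec A B).IsInvertible := isInvertible_of_coercive _ (schurPrec_coercive hS)
  have hb : Function.Bijective (saddleOp A B) := by
    have : ⇑(saddleOp A B) = schurPrec A B ∘ WithLp.toLp 2 ∘ lower A B ∘ upper A B ∘ WithLp.ofLp :=
      funext (saddleOp_eq hi)
    rw [this]
    exact hP.bijective.comp ((WithLp.toLp_bijective 2).comp ((lower_bijective A B).comp
      ((upper_bijective A B).comp (WithLp.ofLp_bijective 2))))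
  exact isInvertible_of_bijective (E := PiLp 2 X) (F := StrongDual ℝ (PiLp 2 X))
    (saddleOp A B) hb

/-! ### Bounds of the quadratic forms -/

theorem sum_succ_sub_castSucc (f : Fin (m + 1) → ℝ) :
    f 0 + ∑ i : Fin m, (f i.succ - f i.castSucc) = f (Fin.last m) := by
  have h1 := Fin.sum_univ_succ f
  rw [Fin.sum_univ_castSucc] at h1
  rw [Finset.sum_sub_distrib]
  linarith

theorem abs_saddleOp_apply_self_le (hi : ∀ i, (schur A B i).IsInvertible)
    (hA_symm : ∀ i (x y : X i), A i y x = A i x y)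
    (hA_nonneg : ∀ i (x : X i), 0 ≤ A i x x)
    (hS : ∀ i (x : X i), 0 ≤ schur A B i x x)
    {ψ : ℝ} (hψ : (2 * m + 3) * ψ = Real.pi / 2) (x : PiLp 2 X) :
    |saddleOp A B x x| ≤ 2 * Real.cos (2 * ψ) * schurPrec A B x x := by
  obtain ⟨t, ht0, ht, htm⟩ := exists_pivots m hψ
  -- The sign `σ = ±1` handles both halves of the absolute value at once.
  have key : ∀ σ : ℝ, σ ^ 2 = 1 →
      σ * saddleOp A B x x ≤ 2 * Real.cos (2 * ψ) * schurPrec A B x x := by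
    intro σ hσ
    have hσ1 : ∀ k : ℕ, |σ * (-1) ^ k| ≤ 1 := fun k => by
      rw [abs_mul, abs_pow, abs_neg, abs_one, one_pow, mul_one,
        ← sq_le_sq₀ (abs_nonneg _) zero_le_one, sq_abs, hσ, one_pow]
    rw [saddleOp_apply, schurPrec_apply, Fin.sum_univ_succ, Fin.sum_univ_succ, add_assoc,
      ← Finset.sum_add_distrib, mul_add, mul_add, Finset.mul_sum, Finset.mul_sum]
    have htel := sum_succ_sub_castSucc fun i : Fin (m + 1) => t i * schur A B i (x i) (x i)
    have hlast : 0 ≤ t m * schur A B (Fin.last m) (x (Fin.last m)) (x (Fin.last m)) :=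
      mul_nonneg htm (hS _ _)
    have h0 : σ * A 0 (x 0) (x 0) ≤ schur A B 0 (x 0) (x 0) := by
      have h1 := (abs_le.1 (hσ1 0)).2
      rw [pow_zero, mul_one] at h1
      have := mul_le_mul_of_nonneg_right h1 (hA_nonneg 0 (x 0))
      rwa [one_mul] at this
    have hsum : ∑ i : Fin m, σ * ((-1 : ℝ) ^ (i.succ : ℕ) * A i.succ (x i.succ) (x i.succ) +
          (B i (x i.castSucc) (x i.succ) + B i (x i.castSucc) (x i.succ))) ≤
        ∑ i : Fin m, (2 * Real.cos (2 * ψ) * schur A B i.succ (x i.succ) (x i.succ) -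
          (t (i.succ : ℕ) * schur A B i.succ (x i.succ) (x i.succ) -
            t (i.castSucc : ℕ) * schur A B i.castSucc (x i.castSucc) (x i.castSucc))) := by
      refine Finset.sum_le_sum fun i _ => ?_
      obtain ⟨hti, hti1, hts⟩ := ht i i.2
      have hA := hA_nonneg i.succ (x i.succ)
      have hAeq := schur_couplingAdj_self_eq hi i (x i.succ)
      have hB : B i (x i.castSucc) (x i.succ) =
          schur A B i.castSucc (couplingAdj A B i (x i.succ)) (x i.castSucc) := by
        rw [schur_couplingAdj hi, ContinuousLinearMap.flip_apply]
      -- Young's inequality as a square: divided by `tᵢ` it bounds `2σb` by `tᵢ s' + tᵢ⁻¹ c`.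
      have hsq := hS i.castSucc ((t i) • x i.castSucc - σ • couplingAdj A B i (x i.succ))
      simp only [map_sub, map_smul, sub_apply, smul_apply, smul_eq_mul] at hsq
      rw [schur_symm hA_symm hi _ (x i.castSucc) (couplingAdj A B i _), ← hB] at hsq
      rw [Fin.val_succ, Fin.val_castSucc, hts]
      set a := A i.succ (x i.succ) (x i.succ)
      set s := schur A B i.succ (x i.succ) (x i.succ)
      set c := schur A B i.castSucc (couplingAdj A B i (x i.succ)) (couplingAdj A B i (x i.succ))
      set s' := schur A B i.castSucc (x i.castSucc) (x i.castSucc)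
      set b := B i (x i.castSucc) (x i.succ)
      -- Here `tᵢ ≤ 1` matters: the diagonal term fits into `tᵢ⁻¹ a`, and `a + c = s` then leaves
      -- just `tᵢ⁻¹ s`.
      have h1 : σ * (-1) ^ ((i : ℕ) + 1) * a ≤ (t i)⁻¹ * a :=
        mul_le_mul_of_nonneg_right
          ((abs_le.1 (hσ1 _)).2.trans ((one_le_inv₀ hti).2 hti1)) hA
      have h2 : 2 * σ * b ≤ t i * s' + (t i)⁻¹ * c := by
        have h3 : 0 ≤ (t i)⁻¹ * (t i * (t i * s') - 2 * (t i * σ * b) + σ ^ 2 * c) :=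
          mul_nonneg (inv_nonneg.2 hti.le) (by nlinarith)
        rw [hσ] at h3
        have h4 : (t i)⁻¹ * (t i * (t i * s') - 2 * (t i * σ * b) + 1 * c) =
            t i * s' - 2 * σ * b + (t i)⁻¹ * c := by
          field_simp
        linarith
      have h3 : c = s - a := by linarith
      rw [h3] at h2
      nlinarith
    rw [Finset.sum_sub_distrib] at hsum
    simp only [Fin.val_last, Fin.val_zero] at htel
    simp only [Fin.val_zero, pow_zero, one_mul]
    rw [ht0] at htel
    linarith
  refine abs_le'.2 ⟨?_, ?_⟩
  · simpa using key 1 (by norm_num)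
  · simpa using key (-1) (by norm_num)

theorem mul_alternating_sum_le (hi : ∀ i, (schur A B i).IsInvertible)
    (hA_symm : ∀ i (x y : X i), A i y x = A i x y)
    (hA_nonneg : ∀ i (x : X i), 0 ≤ A i x x)
    (hS : ∀ i (x : X i), 0 ≤ schur A B i x x)
    {ψ : ℝ} (hψ : (2 * m + 3) * ψ = Real.pi / 2) (σ : ℝ) (hσ : σ ^ 2 = 1) (g : ∀ i, X i) :
    2 * Real.sin ψ * (σ * ∑ i : Fin (m + 1), (-1 : ℝ) ^ (i : ℕ) * schur A B i (g i) (g i)) ≤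
      ∑ i, schur A B i (lower A B g i) (lower A B g i) := by
  obtain ⟨r, hr0, hr, hr1⟩ := exists_alternating_pivots m hψ σ hσ
  -- The telescoping weights are `rᵢ - 1`: the `rᵢ` come from the square, and the `1` from bounding
  -- the energy of `Cᵢ gᵢ` by that of `gᵢ`, which needs `1 ≤ rᵢ`.
  have htel := sum_succ_sub_castSucc fun i : Fin (m + 1) => (r i - 1) * schur A B i (g i) (g i)
  have hlast : 0 ≤ (r m - 1) * schur A B (Fin.last m) (g (Fin.last m)) (g (Fin.last m)) :=
    mul_nonneg (sub_nonneg.2 (hr1 m le_rfl)) (hS _ _)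
  rw [← mul_assoc, Finset.mul_sum, Fin.sum_univ_succ, Fin.sum_univ_succ, lower_zero]
  have hsum : ∑ i : Fin m, ((r (i.succ : ℕ) - 1) * schur A B i.succ (g i.succ) (g i.succ) -
        (r (i.castSucc : ℕ) - 1) * schur A B i.castSucc (g i.castSucc) (g i.castSucc)) ≤
      ∑ i : Fin m, (schur A B i.succ (lower A B g i.succ) (lower A B g i.succ) -
        2 * Real.sin ψ * σ * ((-1 : ℝ) ^ (i.succ : ℕ) *
          schur A B i.succ (g i.succ) (g i.succ))) := by
    refine Finset.sum_le_sum fun i _ => ?_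
    have hri := hr1 i i.2.le
    have hrpos : 0 < r i := by linarith
    have hC := mul_le_mul_of_nonneg_left
      (schur_couplingOp_self_le hi hA_symm hA_nonneg hS i (g i.castSucc)) (sub_nonneg.2 hri)
    have hε : (-1 : ℝ) ^ (i : ℕ) * (-1) ^ (i : ℕ) = 1 := by rw [← mul_pow]; simp
    have hsq := hS i.succ (g i.succ + (r i * (-1) ^ (i : ℕ)) • couplingOp A B i (g i.castSucc))
    rw [lower_succ]
    simp only [map_add, map_smul, add_apply, smul_apply, smul_eq_mul] at hsq ⊢
    rw [schur_symm hA_symm hi _ (g i.succ) (couplingOp A B i _)] at hsq ⊢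
    rw [Fin.val_succ, Fin.val_castSucc, hr i i.2]
    set s := schur A B i.succ (g i.succ) (g i.succ)
    set c := schur A B i.succ (couplingOp A B i (g i.castSucc)) (couplingOp A B i (g i.castSucc))
    set s' := schur A B i.castSucc (g i.castSucc) (g i.castSucc)
    set b := schur A B i.succ (couplingOp A B i (g i.castSucc)) (g i.succ)
    have h3 := mul_nonneg (inv_nonneg.2 hrpos.le) hsq
    have h4 : (r i)⁻¹ * r i = 1 := inv_mul_cancel₀ hrpos.ne'
    have h5 : (r i)⁻¹ * (s + r i * (-1) ^ (i : ℕ) * b +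
        r i * (-1) ^ (i : ℕ) * (b + r i * (-1) ^ (i : ℕ) * c)) =
        (r i)⁻¹ * s + 2 * (-1) ^ (i : ℕ) * b + r i * c := by
      linear_combination (2 * (-1) ^ (i : ℕ) * b + r i * c) * h4 +
        (r i)⁻¹ * r i * r i * c * hε
    have h6 : (-1 : ℝ) ^ (i : ℕ) * ((-1) ^ (i : ℕ) * c) = c := by rw [← mul_assoc, hε, one_mul]
    rw [h5] at h3
    linear_combination h3 + hC - h6
  rw [Finset.sum_sub_distrib, Finset.sum_sub_distrib] at hsum
  rw [Finset.sum_sub_distrib] at htel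
  simp only [Fin.val_last, Fin.val_zero, hr0] at htel
  simp only [Fin.val_zero, pow_zero, one_mul]
  linarith

/-- Block LDLᵀ form of `𝒜`: completing squares leaves the energies of `Cᵢ* xᵢ₊₁`, which the energy
balance for `Aᵢ₊₁` cancels. -/
theorem saddleOp_apply_self_eq (hi : ∀ i, (schur A B i).IsInvertible)
    (hA_symm : ∀ i (x y : X i), A i y x = A i x y) (x : PiLp 2 X) :
    saddleOp A B x x = ∑ i : Fin (m + 1), (-1 : ℝ) ^ (i : ℕ) *
      schur A B i (upper A B x.ofLp i) (upper A B x.ofLp i) := by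
  have hε : ∀ k : ℕ, (-1 : ℝ) ^ k * (-1) ^ k = 1 := fun k => by rw [← mul_pow]; simp
  have h : ∑ i : Fin (m + 1), (-1 : ℝ) ^ (i : ℕ) *
      schur A B i (upper A B x.ofLp i) (upper A B x.ofLp i) =
      ∑ i : Fin (m + 1), (-1 : ℝ) ^ (i : ℕ) * schur A B i (x i) (x i) +
      ∑ i : Fin m, (2 * B i (x i.castSucc) (x i.succ) + (-1) ^ (i : ℕ) *
        schur A B i.castSucc (couplingAdj A B i (x i.succ)) (couplingAdj A B i (x i.succ))) := by
    rw [Fin.sum_univ_castSucc, Fin.sum_univ_castSucc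
      (fun i : Fin (m + 1) => (-1 : ℝ) ^ (i : ℕ) * schur A B i (x i) (x i)), add_right_comm,
      ← Finset.sum_add_distrib]
    congr 1
    · refine Finset.sum_congr rfl fun i _ => ?_
      rw [upper_castSucc]
      simp only [map_add, map_smul, add_apply, smul_apply, smul_eq_mul, Fin.val_castSucc]
      rw [schur_symm hA_symm hi _ (x.ofLp i.castSucc) (couplingAdj A B i _),
        schur_couplingAdj hi i, ContinuousLinearMap.flip_apply]
      linear_combination ((-1) ^ (i : ℕ) * schur A B i.castSucc (x i.castSucc) (x i.castSucc) +
        2 * B i (x i.castSucc) (x i.succ)) * hε i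
    · rw [upper_last]
      simp only [map_smul, smul_apply, smul_eq_mul, Fin.val_last]
      linear_combination ((-1) ^ m * schur A B (Fin.last m) (x (Fin.last m)) (x (Fin.last m))) * hε m
  rw [h, saddleOp_apply, Fin.sum_univ_succ, Fin.sum_univ_succ, add_assoc, add_assoc,
    ← Finset.sum_add_distrib, ← Finset.sum_add_distrib, schur_zero]
  refine congrArg _ (Finset.sum_congr rfl fun i _ => ?_)
  rw [schur_couplingAdj_self_eq hi, Fin.val_succ]
  ring

/-- Here `y = ℳ x`, so `⟨𝒜 x, x⟩ = ⟨𝒮 ℳ⁻¹ y, y⟩` and this bounds the quadratic form of `ℳ⁻¹`. -/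
theorem mul_abs_saddleOp_apply_self_le (hi : ∀ i, (schur A B i).IsInvertible)
    (hA_symm : ∀ i (x y : X i), A i y x = A i x y)
    (hA_nonneg : ∀ i (x : X i), 0 ≤ A i x x)
    (hS : ∀ i (x : X i), 0 ≤ schur A B i x x)
    {ψ : ℝ} (hψ : (2 * m + 3) * ψ = Real.pi / 2) (x y : PiLp 2 X)
    (hxy : schurPrec A B y = saddleOp A B x) (hP : Function.Injective (schurPrec A B)) :
    2 * Real.sin ψ * |saddleOp A B x x| ≤ schurPrec A B y y := by
  obtain rfl : y = WithLp.toLp 2 (lower A B (upper A B x.ofLp)) :=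
    hP (hxy.trans (saddleOp_eq hi x))
  rw [saddleOp_apply_self_eq hi hA_symm, schurPrec_apply]
  have h1 := mul_alternating_sum_le hi hA_symm hA_nonneg hS hψ 1 (by norm_num) (upper A B x.ofLp)
  have h2 := mul_alternating_sum_le hi hA_symm hA_nonneg hS hψ (-1) (by norm_num)
    (upper A B x.ofLp)
  rcases abs_choice (∑ i : Fin (m + 1), (-1 : ℝ) ^ (i : ℕ) *
    schur A B i (upper A B x.ofLp i) (upper A B x.ofLp i)) with h | h <;> rw [h]
  · simpa using h1
  · simpa using h2

/-! ### Condition numbers -/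

theorem condNumber_precOp_le [∀ i, CompleteSpace (X i)]
    (hA_symm : ∀ i (x y : X i), A i y x = A i x y)
    (hA_nonneg : ∀ i (x : X i), 0 ≤ A i x x)
    (hS : ∀ i, ∃ σ : ℝ, 0 < σ ∧ ∀ x : X i, σ * ‖x‖ ^ 2 ≤ schur A B i x x)
    {ψ : ℝ} (hψ : (2 * m + 3) * ψ = Real.pi / 2) :
    condNumber (energyNorm (schurPrec A B)) (energyNorm (schurPrec A B)) (precOp A B) ≤
      ENNReal.ofReal (Real.cos (2 * ψ) / Real.sin ψ) := by
  have hi : ∀ i, (schur A B i).IsInvertible := fun i => isInvertible_of_coercive _ (hS i)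
  have hS0 : ∀ i (x : X i), 0 ≤ schur A B i x x := fun i x => by
    obtain ⟨σ, hσ, h⟩ := hS i
    exact (mul_nonneg hσ.le (sq_nonneg _)).trans (h x)
  have hP : (schurPrec A B).IsInvertible := isInvertible_of_coercive _ (schurPrec_coercive hS)
  have hP0 : ∀ x, 0 ≤ schurPrec A B x x := fun x => by
    rw [schurPrec_apply]
    exact Finset.sum_nonneg fun i _ => hS0 i _
  have hM : (precOp A B).IsInvertible := hP.inverse.comp (saddleOp_isInvertible hS)
  have hPM : ∀ x, schurPrec A B (precOp A B x) = saddleOp A B x := fun x =>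
    hP.self_apply_inverse _
  have hm : (3 : ℝ) ≤ 2 * m + 3 := by linarith [(Nat.cast_nonneg m : (0 : ℝ) ≤ m)]
  have hψe : ψ = Real.pi / 2 / (2 * m + 3) := by rw [← hψ]; field_simp
  have hψ0 : 0 < ψ := by rw [hψe]; have := Real.pi_pos; positivity
  have hψ1 : 3 * ψ ≤ Real.pi / 2 := by rw [← hψ]; exact mul_le_mul_of_nonneg_right hm hψ0.le
  have hsin : 0 < Real.sin ψ := Real.sin_pos_of_pos_of_lt_pi hψ0 (by linarith)
  have hcos : 0 ≤ Real.cos (2 * ψ) := Real.cos_nonneg_of_mem_Icc ⟨by linarith, by linarith⟩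
  have h1 : opNormWrt (energyNorm (schurPrec A B)) (energyNorm (schurPrec A B)) (precOp A B) ≤
      ENNReal.ofReal (2 * Real.cos (2 * ψ)) := by
    refine opNormWrt_energyNorm_le _ hP0 _ (by positivity) (fun x y => ?_) fun x => ?_
    · rw [hPM, hPM, saddleOp_symm hA_symm]
    · rw [hPM]
      exact abs_saddleOp_apply_self_le hi hA_symm hA_nonneg hS0 hψ x
  have h2 : opNormWrt (energyNorm (schurPrec A B)) (energyNorm (schurPrec A B))
      (precOp A B).inverse ≤ ENNReal.ofReal (2 * Real.sin ψ)⁻¹ := by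
    have hinv : ∀ x, schurPrec A B x = saddleOp A B ((precOp A B).inverse x) := fun x => by
      rw [← hPM, hM.self_apply_inverse]
    refine opNormWrt_energyNorm_le _ hP0 _ (by positivity) (fun x y => ?_) fun x => ?_
    · rw [schurPrec_symm hi hA_symm _ y, schurPrec_symm hi hA_symm _ x, hinv, hinv,
        saddleOp_symm hA_symm]
    · rw [schurPrec_symm hi hA_symm _ x, hinv x, ← hinv, le_inv_mul_iff₀ (by positivity), hinv x]
      exact (mul_abs_saddleOp_apply_self_le hi hA_symm hA_nonneg hS0 hψ _ x (hinv x)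
        hP.injective).trans_eq (by rw [hinv x])
  refine (mul_le_mul' h1 h2).trans_eq ?_
  rw [← ENNReal.ofReal_mul (by positivity)]
  congr 1
  field_simp

end Blocks
end MultipleSaddle

theorem corollary2p4 {m : ℕ} {X : Fin (m + 1) → Type*}
    [∀ i, NormedAddCommGroup (X i)] [∀ i, InnerProductSpace ℝ (X i)] [∀ i, CompleteSpace (X i)]
    (A : ∀ i : Fin (m + 1), X i →L[ℝ] StrongDual ℝ (X i))
    (B : ∀ i : Fin m, X i.castSucc →L[ℝ] StrongDual ℝ (X i.succ))
    (hA_symm : ∀ i (x y : X i), A i y x = A i x y)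
    (hA_nonneg : ∀ i (x : X i), 0 ≤ A i x x)
    (hS : ∀ i, ∃ σ : ℝ, 0 < σ ∧ ∀ x : X i, σ * ‖x‖ ^ 2 ≤ MultipleSaddle.schur A B i x x) :
    (MultipleSaddle.saddleOp A B).IsInvertible ∧
    (MultipleSaddle.precOp A B).IsInvertible ∧
    MultipleSaddle.precOp A B = MultipleSaddle.precBlockOp A B ∧
    (∀ (i : Fin m) (x : X i.castSucc) (y : X i.succ),
      MultipleSaddle.schur A B i.castSucc (MultipleSaddle.couplingAdj A B i y) x =
        MultipleSaddle.schur A B i.succ (MultipleSaddle.couplingOp A B i x) y) ∧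
    MultipleSaddle.condNumber
        (MultipleSaddle.energyNorm (MultipleSaddle.schurPrec A B))
        (MultipleSaddle.dualEnergyNorm (MultipleSaddle.schurPrec A B))
        (MultipleSaddle.saddleOp A B) =
      MultipleSaddle.condNumber
        (MultipleSaddle.energyNorm (MultipleSaddle.schurPrec A B))
        (MultipleSaddle.energyNorm (MultipleSaddle.schurPrec A B))
        (MultipleSaddle.precOp A B) ∧
    MultipleSaddle.condNumber
        (MultipleSaddle.energyNorm (MultipleSaddle.schurPrec A B))
        (MultipleSaddle.energyNorm (MultipleSaddle.schurPrec A B))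
        (MultipleSaddle.precOp A B) ≤
      ENNReal.ofReal (Real.cos (Real.pi / (2 * ((m + 1 : ℕ) : ℝ) + 1)) /
        Real.sin (Real.pi / (2 * (2 * ((m + 1 : ℕ) : ℝ) + 1)))) ∧
    (m + 1 = 2 →
      MultipleSaddle.condNumber
          (MultipleSaddle.energyNorm (MultipleSaddle.schurPrec A B))
          (MultipleSaddle.energyNorm (MultipleSaddle.schurPrec A B))
          (MultipleSaddle.precOp A B) ≤
        ENNReal.ofReal ((3 + Real.sqrt 5) / 2)) := by
  have hi : ∀ i, (MultipleSaddle.schur A B i).IsInvertible := fun i =>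
    MultipleSaddle.isInvertible_of_coercive _ (hS i)
  have hc := MultipleSaddle.schurPrec_coercive hS
  have hP := MultipleSaddle.isInvertible_of_coercive _ hc
  have hP0 : ∀ x, 0 ≤ MultipleSaddle.schurPrec A B x x := fun x => by
    obtain ⟨σ, hσ, h⟩ := hc
    exact (mul_nonneg hσ.le (sq_nonneg _)).trans (h x)
  have hT := MultipleSaddle.saddleOp_isInvertible hS
  -- With `n = m + 1` blocks, `2n + 1 = 2m + 3`.
  have hκ := MultipleSaddle.condNumber_precOp_le hA_symm hA_nonneg hS
    (ψ := Real.pi / (2 * (2 * ((m + 1 : ℕ) : ℝ) + 1))) (by push_cast; field_simp; ring)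
  rw [show 2 * (Real.pi / (2 * (2 * ((m + 1 : ℕ) : ℝ) + 1))) =
    Real.pi / (2 * ((m + 1 : ℕ) : ℝ) + 1) by field_simp] at hκ
  refine ⟨hT, hP.inverse.comp hT, ?_, MultipleSaddle.schur_couplingAdj_apply hi,
    MultipleSaddle.condNumber_dualEnergyNorm_eq _ hP0 (MultipleSaddle.schurPrec_symm hi hA_symm)
      hP _ hT, hκ, fun hm => ?_⟩
  · ext1 x
    refine hP.injective ?_
    rw [MultipleSaddle.schurPrec_precBlockOp hi]
    exact hP.self_apply_inverse _
  · have hm' : ((m + 1 : ℕ) : ℝ) = 2 := by exact_mod_cast hm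
    rw [hm'] at hκ
    rwa [show (2 * 2 + 1 : ℝ) = 5 by norm_num, show (2 * 5 : ℝ) = 10 by norm_num,
      MultipleSaddle.cos_pi_div_five_div_sin_pi_div_ten] at hκ
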